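/- **Setting.** Let $\mathcal A$ be a finite alphabet, $D\ge 1$, and give $\mathcal A^{\mathbb Z^D}$ the product topology, with shifts $\sigma^v(a)_z=a_{z+v}$. Let $\Phi:\mathcal A^{\mathbb Z^D}\to\mathcal A^{\mathbb Z^D}$ be a cellular automaton (continuous, commuting with all shifts) and $\mathfrak A\subseteq\mathcal A^{\mathbb Z^D}$ a subshift (closed, shift-invariant) with $\Phi(\mathfrak A)=\mathfrak A$. *Geometry.* $B(z,r)=z+[-r,r]^D$; $Y(r)=\{y\in Y: B(y,r)\subseteq Y\}$. Two points of $\mathbb Z^D$ are adjacent if their sup-distance is $1$; connectedness of subsets of $\mathbb Z^D$ is through trails of adjacent points. $Y\subseteq\mathbb Z^D$ is *spacious* if it is connected and $Y(r)\ne\emptyset$ for all $r$. $\mathfrak A$ is *projectively transitive* if for every spacious $Y$ and nonempty open $O\subseteq\mathfrak A$, $\bigcup_{y\in Y}\sigma^{-y}(O)$ is dense in $\mathfrak A$; assume this. *Defects.* For a configuration $a$, $\mathcal E_a(z)\in\mathbb N\cup\{\infty\}$ is the largest $r$ such that $a_{B(z,r)}$ occurs in $\mathfrak A$; $G_r(a)=\{z:\mathcal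 E_a(z)\ge r\}$; $\widetilde{\mathfrak A}=\{a:\sup_z\mathcal E_a(z)=\infty\}$. A connected component $C$ of $G_r(a)$ is *projective* if $C\cap G_R(a)\ne\emptyset$ for all $R\ge r$; $a$ has a *projective domain boundary* if some $G_R(a)$ has at least two projective components. *Spectrum.* "A.e." means on a comeager subset of $\mathfrak A$. An a.e. eigenfunction with eigenvalue $\lambda=(\lambda_0;\lambda_1,\dots,\lambda_D)\in\mathbb T^{D+1}$ is a bounded $f:\mathfrak A\to\mathbb C$, not a.e. zero, continuous at each point of a comeager set, with $f\circ\Phi=\lambda_0f$ a.e. and $f\circ\sigma^z=\lambda^zf$ a.e. for all $z\in\mathbb Z^D$, where $\lambda^z=\prod_{i=1}^D\lambda_i^{z_i}$. Let $\mathcal S_{ae}$ be the set of their eigenvalues, and fix an *eigenset* $F=\{f_\lambda\}_{\lambda\in\mathcal S_{ae}}$, one a.e. eigenfunction for each $\lambda$. The rational spectrum $\mathcal S_{rat}$ is the set of eigenvalues of nonzero *continuous* eigenfunctions (equations holding everywhere on $\mathfrak A$) all of whose coordinates are roots of unity. *Good configurations.* The regular set $\underline{\mathfrak A}$ consists of the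 $a\in\mathfrak A$ with $f_\lambda(\Phi^n\sigma^za)=\lambda_0^n\lambda^zf_\lambda(a)$ for all $\lambda\in\mathcal S_{ae}$, $n\in\mathbb N$, $z\in\mathbb Z^D$. For spacious $Y$, $\widehat{\mathfrak A}(Y)$ is the set of $a\in\underline{\mathfrak A}$ such that for all $\lambda\in\mathcal S_{ae}$, $k\in\mathbb N$, $\varepsilon>0$, $n$, $z$, the point $a'=\Phi^n\sigma^za$ has a box $B(y,r)\subseteq Y(k)$ such that $|f_\lambda(\sigma^yb)-f_\lambda(\sigma^ya')|<\varepsilon$ for every $b\in\mathfrak A$ with $b_{B(y,r)}=a'_{B(y,r)}$. For disjoint spacious $Y_1,\dots,Y_N$, $\widehat{\mathfrak A}(Y_1,\dots,Y_N)$ is the set of $a\in\widetilde{\mathfrak A}$ such that for every $r>0$ and every projective component $C$ of $G_r(a)$, $a_C$ extends to a point of $\underline{\mathfrak A}$, and for every $n$, $a_{Y_n}$ extends to a point of $\widehat{\mathfrak A}(Y_n)$. **Theorem.** Let $Y_1,\dots,Y_N\subseteq\mathbb Z^D$ be disjoint and spacious and let $a\in\widehat{\mathfrak A}(Y_1,\dots,Y_N)$.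 For each $n$ and $\lambda\in\mathcal S_{ae}$, $f_\lambda$ takes one and the same nonzero value, denoted $f_\lambda(a_{Y_n})$, at all points of $\underline{\mathfrak A}$ extending $a_{Y_n}$. Put $\delta_{nm}(\lambda)=f_\lambda(a_{Y_n})/f_\lambda(a_{Y_m})$. Then: (a) $\delta_{nm}(\lambda)$ is independent of the choice of eigenfunctions: any other eigenset $F'$ for which $a$ lies in the corresponding set $\widehat{\mathfrak A}'(Y_1,\dots,Y_N)$ gives the same $\delta_{nm}(\lambda)$. (b) $\mathcal S_{ae}$ is a subgroup of $\mathbb T^{D+1}$ and $\delta_{nm}:\mathcal S_{ae}\to\mathbb T$ is a group homomorphism. (c) $\delta_{n\ell}(\lambda)=\delta_{nm}(\lambda)\,\delta_{m\ell}(\lambda)$ for all $n,m,\ell$ and $\lambda\in\mathcal S_{ae}$. (d) If $\delta_{nm}\not\equiv1$, then $a$ has a projective domain boundary between $Y_n$ and $Y_m$, in this sense: $a\notin\mathfrak A$; for all $r>0$ and $R\ge0$, no projective component of $G_r(a)$ contains both $Y_n(R)$ and $Y_m(R)$ (in particular none contains both $Y_n$ and $Y_m$); and if each of $Y_n$, $Y_m$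 lies, up to a margin, in a projective component (that is, $Y_n(R)\subseteq C$ for some $R\ge 0$, $r>0$ and projective component $C$ of $G_r(a)$, and likewise for $Y_m$), then $a$ has a projective domain boundary, and for some $r>0$ and $R\ge 0$ the sets $Y_n(R)$ and $Y_m(R)$ are contained in two different projective components of $G_r(a)$. A set $Y_n$ lies in a projective component up to a margin whenever $Y_n(R)$ is connected for some $R>0$. (e) Let $\lambda\in\mathcal S_{rat}$. Then $\lambda\in\mathcal S_{ae}$. Let $g$ be a nonzero continuous eigenfunction for $\lambda$. Then $g(b)$ depends only on $b_{B(0,r')}$ for some $r'\in\mathbb N$. For any such $r'$ write $g_z(a)$ for the value of $g$ on the block $a_{B(z,r')}$ if this block occurs in $\mathfrak A$, and $\gamma_{y,z}(\lambda)=\lambda^{y-z}g_z(a)/g_y(a)$. Then $\gamma_{z,y}(\lambda)=\delta_{nm}(\lambda)$ for all $y\in Y_n(r')$, $z\in Y_m(r')$. Moreover, for every $r\ge r'+1$ and connected components $C,C'$ of $G_r(a)$ that meet $Y_n(r')$ and $Y_m(r')$ respectively, $\gamma_{z,y}(\lambda)=\delta_{nm}(\lambda)$ for all $y\in C$, $z\in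 C'$; so $\delta_{nm}(\lambda)$ is the displacement that the phase gaps $\gamma$ define between the components. -/

import Mathlib

open Set Filter Topology

noncomputable section

namespace CADefect

variable {A : Type*} {D : ℕ}

/-- Configurations `a = (a_z)_{z ∈ ℤ^D}` over the alphabet `A`; the topology is the product topology
(the Cantor topology when `A` is finite and discrete). -/
abbrev Config (A : Type*) (D : ℕ) : Type _ := (Fin D → ℤ) → A

/-- The shift `σ^v(a)_z = a_{z+v}`. -/
def shift (v : Fin D → ℤ) (a : Config A D) : Config A D := fun z => a (z + v)

/-- Cellular automata: continuous maps that commute with all shifts. -/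
def IsCA [TopologicalSpace A] (Φ : Config A D → Config A D) : Prop :=
  Continuous Φ ∧ ∀ v a, Φ (shift v a) = shift v (Φ a)

/-- Subshifts: closed, shift-invariant sets of configurations. -/
def IsSubshift [TopologicalSpace A] (𝔄 : Set (Config A D)) : Prop :=
  IsClosed 𝔄 ∧ ∀ v : Fin D → ℤ, shift v '' 𝔄 = 𝔄

/-! ### Geometry of the lattice -/

/-- The box `B(z,r) = z + [-r,r]^D`, i.e. the ball of radius `r` for the sup norm. -/
def box (z : Fin D → ℤ) (r : ℕ) : Set (Fin D → ℤ) := {y | ∀ i, |y i - z i| ≤ (r : ℤ)}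

/-- The `r`-interior `Y(r) = {y ∈ Y : B(y,r) ⊆ Y}`. -/
def core (Y : Set (Fin D → ℤ)) (r : ℕ) : Set (Fin D → ℤ) := {y | y ∈ Y ∧ box y r ⊆ Y}

/-- Adjacency: sup-norm distance exactly one. -/
def Adj (y z : Fin D → ℤ) : Prop := y ≠ z ∧ z ∈ box y 1

/-- There is a trail inside `Y` from `x` to `y`. -/
def TrailIn (Y : Set (Fin D → ℤ)) (x y : Fin D → ℤ) : Prop :=
  x ∈ Y ∧ Relation.ReflTransGen (fun u v => Adj u v ∧ v ∈ Y) x y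

def TrailConnected (Y : Set (Fin D → ℤ)) : Prop := ∀ x ∈ Y, ∀ y ∈ Y, TrailIn Y x y

/-- `C` is a (trail-)connected component of `U`. -/
def IsTrailComponent (U C : Set (Fin D → ℤ)) : Prop := ∃ x ∈ U, C = {y | TrailIn U x y}

/-- Spacious sets: trail-connected and containing arbitrarily large boxes. -/
def Spacious (Y : Set (Fin D → ℤ)) : Prop := TrailConnected Y ∧ ∀ r : ℕ, (core Y r).Nonempty

/-- Projective transitivity: for every spacious `Y` and every nonempty relatively open
`O = 𝔄 ∩ U`, the union of the `σ^{-y}(O)`, `y ∈ Y`, is dense in `𝔄`. -/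
def ProjectivelyTransitive [TopologicalSpace A] (𝔄 : Set (Config A D)) : Prop :=
  ∀ Y : Set (Fin D → ℤ), Spacious Y → ∀ U : Set (Config A D), IsOpen U → (𝔄 ∩ U).Nonempty →
    𝔄 ⊆ closure (⋃ y ∈ Y, shift (-y) '' (𝔄 ∩ U))

/-! ### Defects -/

/-- The block `a_{B(z,r)}` is `𝔄`-admissible. (By shift invariance it does not matter whether one
compares with `𝔄_{B(z,r)}` or, after translation, with `𝔄_{B(0,r)}`.) -/
def Admissible (𝔄 : Set (Config A D)) (a : Config A D) (z : Fin D → ℤ) (r : ℕ) : Prop :=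
  ∃ b ∈ 𝔄, EqOn b a (box z r)

/-- The defect field: the largest `r` such that `a_{B(z,r)}` is admissible, possibly `∞`. -/
def defectField (𝔄 : Set (Config A D)) (a : Config A D) (z : Fin D → ℤ) : ℕ∞ :=
  ⨆ (r : ℕ) (_ : Admissible 𝔄 a z r), (r : ℕ∞)

/-- The set of slightly defective configurations. -/
def slightlyDefective (𝔄 : Set (Config A D)) : Set (Config A D) :=
  {a | (⨆ z, defectField 𝔄 a z) = ⊤}

/-- The set of points where the defect field is at least `R`. -/
def unflawed (𝔄 : Set (Config A D)) (a : Config A D) (R : ℕ) : Set (Fin D → ℤ) :=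
  {z | (R : ℕ∞) ≤ defectField 𝔄 a z}

/-- `C` is a projective component of the range-`r` unflawed set of `a`. -/
def IsProjectiveComponent (𝔄 : Set (Config A D)) (a : Config A D) (r : ℕ)
    (C : Set (Fin D → ℤ)) : Prop :=
  IsTrailComponent (unflawed 𝔄 a r) C ∧ ∀ R : ℕ, r ≤ R → (C ∩ unflawed 𝔄 a R).Nonempty

/-- `a` has a projective domain boundary: some unflawed set has two projective components. -/
def HasProjectiveDomainBoundary (𝔄 : Set (Config A D)) (a : Config A D) : Prop :=
  ∃ (R : ℕ) (C C' : Set (Fin D → ℤ)),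
    IsProjectiveComponent 𝔄 a R C ∧ IsProjectiveComponent 𝔄 a R C' ∧ C ≠ C'

/-- Up to a margin, `Y` lies in one projective component. (Only the `r`-interior of a set on which
`a` is admissible is certain to be contained in the range-`r` unflawed set, hence the margin.) -/
def LiesInProjectiveComponent (𝔄 : Set (Config A D)) (a : Config A D)
    (Y : Set (Fin D → ℤ)) : Prop :=
  ∃ r : ℕ, 0 < r ∧ ∃ (R : ℕ) (C : Set (Fin D → ℤ)), IsProjectiveComponent 𝔄 a r C ∧ core Y R ⊆ C

/-- `Y` and `Y'` lie, up to a margin, in two different projective components (of one range). -/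
def ProjectiveDomainBoundaryBetween (𝔄 : Set (Config A D)) (a : Config A D)
    (Y Y' : Set (Fin D → ℤ)) : Prop :=
  ∃ r : ℕ, 0 < r ∧ ∃ (R : ℕ) (C C' : Set (Fin D → ℤ)),
    IsProjectiveComponent 𝔄 a r C ∧ IsProjectiveComponent 𝔄 a r C' ∧ C ≠ C' ∧
      core Y R ⊆ C ∧ core Y' R ⊆ C'

/-! ### Eigenvalues and eigenfunctions

Functions on `𝔄` are represented by functions on all configurations; only their values on `𝔄` enter
the definitions (recall `Φ(𝔄) = 𝔄` and `σ^z(𝔄) = 𝔄`). -/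

/-- `𝕋^{D+1}`, with elements `(λ₀; λ₁, …, λ_D)`. -/
abbrev Torus (D : ℕ) : Type := Circle × (Fin D → Circle)

/-- `λ^z = λ₁^{z₁} ⋯ λ_D^{z_D}`. -/
def spacePow (l : Torus D) (z : Fin D → ℤ) : Circle := ∏ i, l.2 i ^ z i

/-- `f` is a nonzero continuous `(Φ,σ)`-eigenfunction on `𝔄` with eigenvalue `l`. -/
structure IsEigenfunction [TopologicalSpace A] (𝔄 : Set (Config A D))
    (Φ : Config A D → Config A D) (l : Torus D) (f : Config A D → ℂ) : Prop where
  continuousOn : ContinuousOn f 𝔄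
  ca_eq : ∀ a ∈ 𝔄, f (Φ a) = (l.1 : ℂ) * f a
  shift_eq : ∀ z, ∀ a ∈ 𝔄, f (shift z a) = (spacePow l z : ℂ) * f a
  ne_zero : ∃ a ∈ 𝔄, f a ≠ 0

/-- The rational spectrum: eigenvalues of continuous eigenfunctions all of whose coordinates are
roots of unity (equivalently, which have finite order in `𝕋^{D+1}`). -/
def ratSpec [TopologicalSpace A] (𝔄 : Set (Config A D)) (Φ : Config A D → Config A D) :
    Set (Torus D) :=
  {l | (∃ f, IsEigenfunction 𝔄 Φ l f) ∧ IsOfFinOrder l}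

/-- `f` is an a.e. `(Φ,σ)`-eigenfunction on `𝔄` with eigenvalue `l`: bounded, continuous at each
point of a comeager subset of `𝔄`, satisfying the eigenvalue equations off meager subsets of `𝔄`,
and not a.e. zero. Here `residual 𝔄` is the filter of comeager subsets of the space `𝔄`. -/
structure IsAEEigenfunction [TopologicalSpace A] (𝔄 : Set (Config A D))
    (Φ : Config A D → Config A D) (l : Torus D) (f : Config A D → ℂ) : Prop where
  bounded : ∃ C : ℝ, ∀ a ∈ 𝔄, ‖f a‖ ≤ C
  continuousAt : ∀ᶠ a : 𝔄 in residual 𝔄, ContinuousAt (fun x : 𝔄 => f x) a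
  ca_eq : ∀ᶠ a : 𝔄 in residual 𝔄, f (Φ a) = (l.1 : ℂ) * f a
  shift_eq : ∀ z, ∀ᶠ a : 𝔄 in residual 𝔄, f (shift z a) = (spacePow l z : ℂ) * f a
  ne_zero : ¬ ∀ᶠ a : 𝔄 in residual 𝔄, f a = 0

/-- The a.e. spectrum. -/
def aeSpec [TopologicalSpace A] (𝔄 : Set (Config A D)) (Φ : Config A D → Config A D) :
    Set (Torus D) :=
  {l | ∃ f, IsAEEigenfunction 𝔄 Φ l f}

/-- An eigenset: one a.e. eigenfunction `F l` for each `l` in the a.e. spectrum (the values of `F`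
at other `l` are irrelevant). -/
def IsEigenset [TopologicalSpace A] (𝔄 : Set (Config A D)) (Φ : Config A D → Config A D)
    (F : Torus D → Config A D → ℂ) : Prop :=
  ∀ l ∈ aeSpec 𝔄 Φ, IsAEEigenfunction 𝔄 Φ l (F l)

/-! ### Regular points, good points, values on fragments -/

/-- The (largest) invariant set of points of `𝔄` on which all the functions of the eigenset satisfy
`f ∘ Φ^n ∘ σ^z = λ₀^n λ^z f` exactly. -/
def regularSet [TopologicalSpace A] (𝔄 : Set (Config A D)) (Φ : Config A D → Config A D)
    (F : Torus D → Config A D → ℂ) : Set (Config A D) :=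
  {a | a ∈ 𝔄 ∧ ∀ l ∈ aeSpec 𝔄 Φ, ∀ (n : ℕ) (z : Fin D → ℤ),
    F l (Φ^[n] (shift z a)) = (l.1 : ℂ) ^ n * (spacePow l z : ℂ) * F l a}

/-- Points `w ∈ 𝔄` whose `r`-block at the origin determines `f` up to `ε`. -/
def determinedSet (𝔄 : Set (Config A D)) (f : Config A D → ℂ) (r : ℕ) (ε : ℝ) :
    Set (Config A D) :=
  {w | w ∈ 𝔄 ∧ ∀ b ∈ 𝔄, EqOn b w (box 0 r) → ‖f b - f w‖ < ε}

/-- Points `a ∈ 𝔄` such that for some box `B(y,r) ⊆ Y` the block `a_{B(y,r)}` determines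
`f ∘ σ^y` up to `ε`. -/
def locatedSet (𝔄 : Set (Config A D)) (f : Config A D → ℂ) (Y : Set (Fin D → ℤ)) (ε : ℝ) :
    Set (Config A D) :=
  {a | a ∈ 𝔄 ∧ ∃ r : ℕ, ∃ y ∈ core Y r, shift y a ∈ determinedSet 𝔄 f r ε}

/-- The `(Φ,σ)`-invariant set of good points for `Y`: regular points such that every element of
their `(Φ,σ)`-orbit has, for every eigenfunction of the eigenset, every `ε > 0` and every interior
`Y(k)`, a box in `Y(k)` whose block determines the eigenfunction up to `ε`. -/
def goodSet [TopologicalSpace A] (𝔄 : Set (Config A D)) (Φ : Config A D → Config A D)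
    (F : Torus D → Config A D → ℂ) (Y : Set (Fin D → ℤ)) : Set (Config A D) :=
  {a | a ∈ regularSet 𝔄 Φ F ∧ ∀ l ∈ aeSpec 𝔄 Φ, ∀ k : ℕ, ∀ ε : ℝ, 0 < ε →
    ∀ (n : ℕ) (z : Fin D → ℤ), Φ^[n] (shift z a) ∈ locatedSet 𝔄 (F l) (core Y k) ε}

/-- The set `Â(Y₁,…,Y_N)`: slightly defective configurations whose restriction to each projective
component of each unflawed set of range `r > 0` extends to a regular point, and whose restriction
to each `Y_n` extends to a good point for `Y_n`. -/
def hatSet [TopologicalSpace A] (𝔄 : Set (Config A D)) (Φ : Config A D → Config A D)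
    (F : Torus D → Config A D → ℂ) {N : ℕ} (Y : Fin N → Set (Fin D → ℤ)) : Set (Config A D) :=
  {a | a ∈ slightlyDefective 𝔄 ∧
    (∀ r : ℕ, 0 < r → ∀ C, IsProjectiveComponent 𝔄 a r C → ∃ b ∈ regularSet 𝔄 Φ F, EqOn b a C) ∧
    ∀ n, ∃ d ∈ goodSet 𝔄 Φ F (Y n), EqOn d a (Y n)}

open Classical in
/-- The value `f_λ(a_Y)`: the value of `f_λ` at a regular point that extends `a_Y`
(`0` if there is none). -/
def fragmentValue [TopologicalSpace A] (𝔄 : Set (Config A D)) (Φ : Config A D → Config A D)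
    (F : Torus D → Config A D → ℂ) (l : Torus D) (Y : Set (Fin D → ℤ)) (a : Config A D) : ℂ :=
  if h : ∃ b ∈ regularSet 𝔄 Φ F, EqOn b a Y then F l h.choose else 0

/-- `δ_{nm}(λ) = f_λ(a_{Y_n}) / f_λ(a_{Y_m})`. -/
def displacement [TopologicalSpace A] (𝔄 : Set (Config A D)) (Φ : Config A D → Config A D)
    (F : Torus D → Config A D → ℂ) {N : ℕ} (Y : Fin N → Set (Fin D → ℤ)) (a : Config A D)
    (n m : Fin N) (l : Torus D) : ℂ :=
  fragmentValue 𝔄 Φ F l (Y n) a / fragmentValue 𝔄 Φ F l (Y m) a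

/-! ### Rational dislocations -/

/-- On `𝔄`, the function `g` is determined by the block on `B(0,r)`. -/
def HasRadius (𝔄 : Set (Config A D)) (g : Config A D → ℂ) (r : ℕ) : Prop :=
  ∀ b ∈ 𝔄, ∀ c ∈ 𝔄, EqOn b c (box 0 r) → g b = g c

open Classical in
/-- For `g` of radius `r` on `𝔄`: the value `g_z(a) = g(a_{B(z,r)})`, meaningful whenever the block
`a_{B(z,r)}` is admissible. -/
def localValue (𝔄 : Set (Config A D)) (g : Config A D → ℂ) (r : ℕ) (z : Fin D → ℤ)
    (a : Config A D) : ℂ :=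
  if h : ∃ b ∈ 𝔄, EqOn b (shift z a) (box 0 r) then g h.choose else 0

/-- The phase gap `γ_{y,z}(λ) = λ^{y-z} g_z(a) / g_y(a)`. -/
def phaseGap (𝔄 : Set (Config A D)) (g : Config A D → ℂ) (r : ℕ) (l : Torus D) (a : Config A D)
    (y z : Fin D → ℤ) : ℂ :=
  (spacePow l (y - z) : ℂ) * localValue 𝔄 g r z a / localValue 𝔄 g r y a

end CADefect

end

open CADefect

namespace CADefect

variable {A : Type*} {D : ℕ}

/-! ### Lattice geometry and shifts -/

/-! A good point `d n` extends `a` on `Y n`, and boxes deep inside `Y n` determine each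
eigenfunction there up to any ε, once the phase of the shift to the box is divided out. So `F l (d
n)` belongs to the fragment, in two ways. Every regular point that agrees with it on some interior
of `Y n` has this value (`eq_of_mem_goodSet_of_eqOn_core`). At every point of `𝔄` that extends it,
regular or not, the value is the limit of `F l` along comeager sets (`tendsto_of_mem_goodSet`).

Projective transitivity gives ergodicity in the sense of category
(`ProjectivelyTransitive.eventually_const`). Hence eigenfunctions have a.e. constant positive
modulus, their products and conjugates are again eigenfunctions, and those with a common eigenvalue
are a.e. proportional. Limits carry these a.e. relations to the points `d n`
(`eq_of_tendsto_of_eventually_eq`), and the constants cancel in the quotients: this gives (a) and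
(b).

For (d), a component containing interiors of both fragments would have one regular extension,
forcing equal values; if `a` were in `𝔄`, both values would be the limit at `a`. For (e), a
continuous eigenfunction of finite order takes finitely many values, so a finite block determines
it. Its local phase is constant along trails of unflawed points, and on the interior of each `Y n`
it is `F l (d n)` times a constant independent of `n`. -/

lemma shift_zero (a : Config A D) : shift 0 a = a := by
  funext z; simp [shift]

lemma shift_shift (v w : Fin D → ℤ) (a : Config A D) :
    shift v (shift w a) = shift (v + w) a := by
  funext z; simp [shift, add_assoc]

lemma continuous_shift [TopologicalSpace A] (v : Fin D → ℤ) :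
    Continuous (shift v : Config A D → Config A D) :=
  continuous_pi fun z => continuous_apply (z + v)

lemma IsSubshift.shift_mem [TopologicalSpace A] {𝔄 : Set (Config A D)} (h : IsSubshift 𝔄)
    (v : Fin D → ℤ) {a : Config A D} (ha : a ∈ 𝔄) : shift v a ∈ 𝔄 := by
  rw [← h.2 v]; exact mem_image_of_mem _ ha

lemma spacePow_add (l : Torus D) (y z : Fin D → ℤ) :
    spacePow l (y + z) = spacePow l y * spacePow l z := by
  simp [spacePow, zpow_add, Finset.prod_mul_distrib]

lemma spacePow_neg (l : Torus D) (z : Fin D → ℤ) : spacePow l (-z) = (spacePow l z)⁻¹ := by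
  simp [spacePow]

lemma spacePow_mul (l l' : Torus D) (z : Fin D → ℤ) :
    spacePow (l * l') z = spacePow l z * spacePow l' z := by
  simp [spacePow, mul_zpow, Finset.prod_mul_distrib]

lemma spacePow_one (z : Fin D → ℤ) : spacePow (1 : Torus D) z = 1 := by
  simp [spacePow]

lemma spacePow_inv (l : Torus D) (z : Fin D → ℤ) : spacePow l⁻¹ z = (spacePow l z)⁻¹ := by
  simp [spacePow]

lemma spacePow_pow (l : Torus D) (q : ℕ) (z : Fin D → ℤ) :
    spacePow (l ^ q) z = spacePow l z ^ q := by
  induction q with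
  | zero => simp [spacePow_one]
  | succ q ih => rw [pow_succ, pow_succ, spacePow_mul, ih]

lemma box_mono (z : Fin D → ℤ) {r s : ℕ} (h : r ≤ s) : box z r ⊆ box z s :=
  fun y hy i => (hy i).trans (by exact_mod_cast h)

lemma box_subset_box {u v : Fin D → ℤ} {r s t : ℕ} (hv : v ∈ box u s) (h : r + s ≤ t) :
    box v r ⊆ box u t := fun y hy i => by
  have h1 := hy i
  have h2 := hv i
  have h3 : ((r + s : ℕ) : ℤ) ≤ t := by exact_mod_cast h
  push_cast at h3
  calc |y i - u i| = |(y i - v i) + (v i - u i)| := by ring_nf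
    _ ≤ |y i - v i| + |v i - u i| := abs_add_le _ _
    _ ≤ t := by linarith

lemma finite_box (z : Fin D → ℤ) (r : ℕ) : (box z r).Finite := by
  refine (Set.Finite.pi' (t := fun i => Icc (z i - r) (z i + r))
    fun i => Set.finite_Icc _ _).subset ?_
  intro y hy i
  have := abs_le.1 (hy i)
  constructor <;> linarith [this.1, this.2]

lemma core_antitone (Y : Set (Fin D → ℤ)) {r s : ℕ} (h : r ≤ s) : core Y s ⊆ core Y r :=
  fun _ hy => ⟨hy.1, (box_mono _ h).trans hy.2⟩

lemma core_subset (Y : Set (Fin D → ℤ)) (r : ℕ) : core Y r ⊆ Y := fun _ hy => hy.1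

lemma eqOn_shift_box_zero {a b : Config A D} {y : Fin D → ℤ} {r : ℕ} :
    EqOn (shift y b) (shift y a) (box 0 r) ↔ EqOn b a (box y r) := by
  constructor
  · intro h x hx
    have := @h (x - y) fun i => by simpa using hx i
    simpa [shift] using this
  · intro h x hx
    exact h fun i => by simpa using hx i

lemma TrailIn.mem_right {U : Set (Fin D → ℤ)} {x y : Fin D → ℤ} (h : TrailIn U x y) : y ∈ U := by
  obtain ⟨hx, h⟩ := h
  induction h with
  | refl => exact hx
  | tail _ h _ => exact h.2

lemma TrailIn.mono {U V : Set (Fin D → ℤ)} (hUV : U ⊆ V) {x y : Fin D → ℤ} (h : TrailIn U x y) :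
    TrailIn V x y :=
  ⟨hUV h.1, Relation.ReflTransGen.mono (fun _ _ hab => ⟨hab.1, hUV hab.2⟩) _ _ h.2⟩

lemma Adj.symm {x y : Fin D → ℤ} (h : Adj x y) : Adj y x :=
  ⟨h.1.symm, fun i => by rw [abs_sub_comm]; exact h.2 i⟩

lemma TrailIn.trans {U : Set (Fin D → ℤ)} {x y z : Fin D → ℤ} (h : TrailIn U x y)
    (h' : TrailIn U y z) : TrailIn U x z :=
  ⟨h.1, h.2.trans h'.2⟩

lemma TrailIn.symm {U : Set (Fin D → ℤ)} {x y : Fin D → ℤ} (h : TrailIn U x y) :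
    TrailIn U y x := by
  obtain ⟨hx, h⟩ := h
  induction h with
  | refl => exact ⟨hx, .refl⟩
  | @tail b c hb hbc ih =>
    exact TrailIn.trans ⟨hbc.2, .single ⟨hbc.1.symm, ih.1⟩⟩ ih

lemma trailIn_univ_of_mem_box (k : ℕ) (x y : Fin D → ℤ) (h : y ∈ box x k) :
    TrailIn univ x y := by
  induction k generalizing x with
  | zero =>
    have : y = x := funext fun i => by
      have := h i
      simpa [sub_eq_zero] using this
    subst this
    exact ⟨mem_univ _, .refl⟩
  | succ k ih =>
    -- Move every coordinate one unit towards `y`; this lowers the sup-distance by one.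
    set x' : Fin D → ℤ := fun i => x i + (y i - x i).sign with hx'
    have hy : y ∈ box x' k := fun i => by
      have hi := abs_le.1 (h i)
      push_cast at hi
      simp only [hx']
      rw [abs_le]
      rcases lt_trichotomy (y i - x i) 0 with h0 | h0 | h0
      · rw [Int.sign_eq_neg_one_of_neg h0]; omega
      · rw [h0]; simp; omega
      · rw [Int.sign_eq_one_of_pos h0]; omega
    by_cases hxx : x = x'
    · rw [hxx]; exact ih x' hy
    · refine TrailIn.trans ⟨mem_univ _, .single ⟨⟨hxx, fun i => ?_⟩, mem_univ _⟩⟩ (ih x' hy)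
      simp only [hx', add_sub_cancel_left]
      rcases lt_trichotomy (y i - x i) 0 with h0 | h0 | h0
      · rw [Int.sign_eq_neg_one_of_neg h0]; simp
      · rw [h0]; simp
      · rw [Int.sign_eq_one_of_pos h0]; simp

lemma spacious_univ : Spacious (univ : Set (Fin D → ℤ)) := by
  refine ⟨fun x _ y _ => trailIn_univ_of_mem_box (∑ i, (y i - x i).natAbs) x y fun i => ?_,
    fun r => ⟨0, mem_univ _, subset_univ _⟩⟩
  rw [Int.abs_eq_natAbs]
  exact_mod_cast Finset.single_le_sum (f := fun i => (y i - x i).natAbs)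
    (fun _ _ => Nat.zero_le _) (Finset.mem_univ i)

/-! ### Unflawed sets and their projective components -/

lemma Admissible.mono {𝔄 : Set (Config A D)} {a : Config A D} {z : Fin D → ℤ} {r s : ℕ}
    (h : Admissible 𝔄 a z s) (hrs : r ≤ s) : Admissible 𝔄 a z r := by
  obtain ⟨b, hb, hba⟩ := h
  exact ⟨b, hb, hba.mono (box_mono z hrs)⟩

lemma Admissible.mem_unflawed {𝔄 : Set (Config A D)} {a : Config A D} {z : Fin D → ℤ} {r : ℕ}
    (h : Admissible 𝔄 a z r) : z ∈ unflawed 𝔄 a r :=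
  le_iSup₂ (f := fun (s : ℕ) (_ : Admissible 𝔄 a z s) => (s : ℕ∞)) r h

/-- Positivity of `r` matters: an empty supremum is `0`, so `unflawed 𝔄 a 0` also contains points
where no block is admissible. -/
lemma admissible_of_mem_unflawed {𝔄 : Set (Config A D)} {a : Config A D} {z : Fin D → ℤ} {r : ℕ}
    (hr : 0 < r) (h : z ∈ unflawed 𝔄 a r) : Admissible 𝔄 a z r := by
  by_contra hn
  have h1 : defectField 𝔄 a z ≤ ((r - 1 : ℕ) : ℕ∞) := by
    refine iSup₂_le fun s hs => ?_
    have : s < r := lt_of_not_ge fun hrs => hn (hs.mono hrs)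
    exact_mod_cast Nat.le_sub_one_of_lt this
  have h2 : (r : ℕ∞) ≤ ((r - 1 : ℕ) : ℕ∞) := le_trans h h1
  have h3 : r ≤ r - 1 := by exact_mod_cast h2
  omega

lemma unflawed_antitone (𝔄 : Set (Config A D)) (a : Config A D) {r s : ℕ} (h : r ≤ s) :
    unflawed 𝔄 a s ⊆ unflawed 𝔄 a r :=
  fun _ hz => le_trans (by exact_mod_cast h) (show (s : ℕ∞) ≤ _ from hz)

/-- Lowering the range only enlarges components. This brings two components of different ranges to a
common range. -/
lemma IsProjectiveComponent.exists_superset {𝔄 : Set (Config A D)} {a : Config A D} {r s : ℕ}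
    {C : Set (Fin D → ℤ)} (h : IsProjectiveComponent 𝔄 a s C) (hrs : r ≤ s) :
    ∃ C', IsProjectiveComponent 𝔄 a r C' ∧ C ⊆ C' := by
  obtain ⟨⟨x, hx, rfl⟩, h⟩ := h
  have hsub : {y | TrailIn (unflawed 𝔄 a s) x y} ⊆ {y | TrailIn (unflawed 𝔄 a r) x y} :=
    fun y hy => hy.mono (unflawed_antitone 𝔄 a hrs)
  refine ⟨_, ⟨⟨x, unflawed_antitone 𝔄 a hrs hx, rfl⟩, fun R _ => ?_⟩, hsub⟩
  obtain ⟨y, hy, hyR⟩ := h (max s R) (le_max_left _ _)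
  exact ⟨y, hsub hy, unflawed_antitone 𝔄 a (le_max_right _ _) hyR⟩

lemma core_subset_unflawed {𝔄 : Set (Config A D)} {a d : Config A D} {Y : Set (Fin D → ℤ)}
    (hd : d ∈ 𝔄) (hda : EqOn d a Y) (r : ℕ) : core Y r ⊆ unflawed 𝔄 a r :=
  fun _ hy => Admissible.mem_unflawed ⟨d, hd, hda.mono hy.2⟩

lemma liesInProjectiveComponent_of_trailConnected_core {𝔄 : Set (Config A D)} {a d : Config A D}
    {Y : Set (Fin D → ℤ)} (hY : Spacious Y) (hd : d ∈ 𝔄) (hda : EqOn d a Y) {R : ℕ} (hR : 0 < R)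
    (hc : TrailConnected (core Y R)) : LiesInProjectiveComponent 𝔄 a Y := by
  obtain ⟨x, hx⟩ := hY.2 R
  have hsub : core Y R ⊆ {y | TrailIn (unflawed 𝔄 a R) x y} :=
    fun y hy => (hc x hx y hy).mono (core_subset_unflawed hd hda R)
  refine ⟨R, hR, R, _, ⟨⟨x, core_subset_unflawed hd hda R hx, rfl⟩, fun R' hR' => ?_⟩, hsub⟩
  obtain ⟨y, hy⟩ := hY.2 R'
  exact ⟨y, hsub (core_antitone Y hR' hy), core_subset_unflawed hd hda R' hy⟩

lemma nonempty_of_mem_slightlyDefective {𝔄 : Set (Config A D)} {a : Config A D}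
    (h : a ∈ slightlyDefective 𝔄) : 𝔄.Nonempty := by
  by_contra hne
  rw [not_nonempty_iff_eq_empty] at hne
  subst hne
  simp [slightlyDefective, defectField, Admissible] at h

/-! ### Ergodicity of subshifts with respect to comeager sets -/

lemma IsSubshift.compactSpace [Finite A] [TopologicalSpace A] {𝔄 : Set (Config A D)}
    (h : IsSubshift 𝔄) : CompactSpace 𝔄 :=
  isCompact_iff_compactSpace.1 h.1.isCompact

lemma IsSubshift.baireSpace [Finite A] [TopologicalSpace A] [DiscreteTopology A]
    {𝔄 : Set (Config A D)} (h : IsSubshift 𝔄) : BaireSpace 𝔄 :=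
  haveI := h.compactSpace
  inferInstance

/-- Comeager sets are dense in a Baire space. Hence limits along this filter are unique, which lets
a.e. identities be evaluated at points that need not be generic. -/
lemma nhds_inf_residual_neBot {X : Type*} [TopologicalSpace X] [BaireSpace X] (x : X) :
    (𝓝 x ⊓ residual X).NeBot := by
  rw [inf_neBot_iff]
  intro s hs t ht
  rw [inter_comm]
  exact (dense_of_mem_residual ht).inter_nhds_nonempty hs

lemma residual_neBot {X : Type*} [TopologicalSpace X] [BaireSpace X] [Nonempty X] :
    (residual X).NeBot :=
  (nhds_inf_residual_neBot (Classical.arbitrary X)).mono inf_le_right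

lemma ProjectivelyTransitive.exists_shift_mem [TopologicalSpace A] {𝔄 : Set (Config A D)}
    (h𝔄 : IsSubshift 𝔄) (h : ProjectivelyTransitive 𝔄) {U V : Set (Config A D)} (hU : IsOpen U)
    (hV : IsOpen V) (hUne : (𝔄 ∩ U).Nonempty) (hVne : (𝔄 ∩ V).Nonempty) :
    ∃ z, ∃ w ∈ 𝔄 ∩ V, shift z w ∈ U := by
  obtain ⟨v, hv, hvV⟩ := hVne
  obtain ⟨w, hwV, hw⟩ := mem_closure_iff.1 (h univ spacious_univ U hU hUne hv) V hV hvV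
  simp only [mem_iUnion] at hw
  obtain ⟨y, -, u, hu, rfl⟩ := hw
  exact ⟨y, _, ⟨h𝔄.shift_mem _ hu.1, hwV⟩, by rw [shift_shift]; simpa [shift_zero] using hu.2⟩

/-- On a projectively transitive subshift, a shift-invariant function that is continuous at the
points of a comeager set is constant on a comeager set. -/
lemma ProjectivelyTransitive.eventually_const [TopologicalSpace A] {𝔄 : Set (Config A D)}
    [BaireSpace 𝔄] (h𝔄 : IsSubshift 𝔄) (h : ProjectivelyTransitive 𝔄) (hne : 𝔄.Nonempty)
    {f : Config A D → ℂ}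
    (hc : ∀ᶠ a : 𝔄 in residual 𝔄, ContinuousAt (fun x : 𝔄 => f x) a)
    (hs : ∀ z, ∀ᶠ a : 𝔄 in residual 𝔄, f (shift z a) = f a) :
    ∃ c, ∀ᶠ a : 𝔄 in residual 𝔄, f a = c := by
  have := hne.to_subtype
  have := residual_neBot (X := 𝔄)
  obtain ⟨a₀, h₀⟩ := hc.exists
  refine ⟨f a₀, hc.mono fun a ha => ?_⟩
  by_contra hfa
  have hε : 0 < dist (f a) (f a₀) / 2 := half_pos (dist_pos.2 hfa)
  have key : ∀ x : 𝔄, ContinuousAt (fun x : 𝔄 => f x) x →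
      ∃ U : Set (Config A D), IsOpen U ∧ (x : Config A D) ∈ U ∧
        ∀ w ∈ 𝔄, w ∈ U → dist (f w) (f x) < dist (f a) (f a₀) / 2 := by
    intro x hx
    have hn := hx (Metric.ball_mem_nhds _ hε)
    obtain ⟨V, hVsub, hV, hxV⟩ := mem_nhds_iff.1 hn
    obtain ⟨U, hU, rfl⟩ := isOpen_induced_iff.1 hV
    exact ⟨U, hU, hxV, fun w hw hwU => hVsub (show (⟨w, hw⟩ : 𝔄) ∈ _ from hwU)⟩
  obtain ⟨U, hU, haU, hUf⟩ := key a ha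
  obtain ⟨V, hV, haV, hVf⟩ := key a₀ h₀
  obtain ⟨z, w, ⟨hw, hwV⟩, hwU⟩ :=
    h.exists_shift_mem h𝔄 hU hV ⟨a, a.2, haU⟩ ⟨a₀, a₀.2, haV⟩
  have hopen : ∀ᶠ x : 𝔄 in 𝓝 ⟨w, hw⟩, (x : Config A D) ∈ V ∧ shift z x ∈ U := by
    refine IsOpen.mem_nhds ?_ ⟨hwV, hwU⟩
    exact (hV.preimage continuous_subtype_val).inter
      (hU.preimage ((continuous_shift z).comp continuous_subtype_val))
  -- Invariance under `shift z` may fail at `w` itself, so `w` is replaced by a nearby point of the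
  -- comeager set where it holds.
  have := nhds_inf_residual_neBot (⟨w, hw⟩ : 𝔄)
  obtain ⟨x, ⟨hxV, hxU⟩, hxs⟩ :=
    ((hopen.filter_mono inf_le_left).and ((hs z).filter_mono inf_le_right)).exists
  have h1 := hUf _ (h𝔄.shift_mem z x.2) hxU
  have h2 := hVf _ x.2 hxV
  rw [hxs] at h1
  have := dist_triangle_left (f a) (f a₀) (f x)
  linarith

/-! ### The group of eigenvalues -/

section Spectrum

variable [TopologicalSpace A] {𝔄 : Set (Config A D)} {Φ : Config A D → Config A D}
  {l l' : Torus D} {f g : Config A D → ℂ}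

lemma IsAEEigenfunction.eventually_norm_eq [BaireSpace 𝔄] (h𝔄 : IsSubshift 𝔄)
    (h : ProjectivelyTransitive 𝔄) (hne : 𝔄.Nonempty) (hf : IsAEEigenfunction 𝔄 Φ l f) :
    ∃ c : ℝ, 0 < c ∧ ∀ᶠ a : 𝔄 in residual 𝔄, ‖f a‖ = c := by
  obtain ⟨c, hc⟩ := h.eventually_const h𝔄 hne (f := fun a => ((‖f a‖ : ℝ) : ℂ))
    (hf.continuousAt.mono fun a ha => Complex.continuous_ofReal.continuousAt.comp ha.norm)
    (fun z => (hf.shift_eq z).mono fun a ha => by rw [ha, norm_mul, Circle.norm_coe, one_mul])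
  have hc' : ∀ᶠ a : 𝔄 in residual 𝔄, ‖f a‖ = ‖c‖ := hc.mono fun a ha => by
    rw [← ha]; simp
  refine ⟨‖c‖, norm_pos_iff.2 ?_, hc'⟩
  rintro rfl
  exact hf.ne_zero (hc'.mono fun a ha => by simpa using ha)

lemma IsAEEigenfunction.eventually_ne_zero [BaireSpace 𝔄] (h𝔄 : IsSubshift 𝔄)
    (h : ProjectivelyTransitive 𝔄) (hne : 𝔄.Nonempty) (hf : IsAEEigenfunction 𝔄 Φ l f) :
    ∀ᶠ a : 𝔄 in residual 𝔄, f a ≠ 0 := by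
  obtain ⟨c, hc, hfc⟩ := hf.eventually_norm_eq h𝔄 h hne
  exact hfc.mono fun a ha => norm_pos_iff.1 (ha ▸ hc)

lemma IsAEEigenfunction.conj (hf : IsAEEigenfunction 𝔄 Φ l f) :
    IsAEEigenfunction 𝔄 Φ l⁻¹ (fun a => star (f a)) where
  bounded := by simpa using hf.bounded
  continuousAt := hf.continuousAt.mono fun a ha => ha.star
  ca_eq := hf.ca_eq.mono fun a ha => by
    rw [ha, star_mul', Prod.fst_inv, Circle.coe_inv_eq_conj]; rfl
  shift_eq z := (hf.shift_eq z).mono fun a ha => by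
    rw [ha, star_mul', spacePow_inv, Circle.coe_inv_eq_conj]; rfl
  ne_zero h0 := hf.ne_zero (h0.mono fun a ha => by simpa using ha)

lemma IsAEEigenfunction.mul [BaireSpace 𝔄] (h𝔄 : IsSubshift 𝔄)
    (h : ProjectivelyTransitive 𝔄) (hne : 𝔄.Nonempty) (hf : IsAEEigenfunction 𝔄 Φ l f)
    (hg : IsAEEigenfunction 𝔄 Φ l' g) :
    IsAEEigenfunction 𝔄 Φ (l * l') (fun a => f a * g a) where
  bounded := by
    obtain ⟨C, hC⟩ := hf.bounded
    obtain ⟨C', hC'⟩ := hg.bounded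
    refine ⟨C * C', fun a ha => ?_⟩
    rw [norm_mul]
    exact mul_le_mul (hC a ha) (hC' a ha) (norm_nonneg _) ((norm_nonneg _).trans (hC a ha))
  continuousAt := (hf.continuousAt.and hg.continuousAt).mono fun a ha => ha.1.mul ha.2
  ca_eq := (hf.ca_eq.and hg.ca_eq).mono fun a ha => by
    rw [ha.1, ha.2, Prod.fst_mul, Circle.coe_mul]; ring
  shift_eq z := ((hf.shift_eq z).and (hg.shift_eq z)).mono fun a ha => by
    rw [ha.1, ha.2, spacePow_mul, Circle.coe_mul]; ring
  ne_zero h0 := by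
    have := hne.to_subtype
    have := residual_neBot (X := 𝔄)
    obtain ⟨a, ha, hfa, hga⟩ := (h0.and ((hf.eventually_ne_zero h𝔄 h hne).and
      (hg.eventually_ne_zero h𝔄 h hne))).exists
    exact mul_ne_zero hfa hga ha

lemma isAEEigenfunction_one [BaireSpace 𝔄] (hne : 𝔄.Nonempty) :
    IsAEEigenfunction 𝔄 Φ 1 (fun _ => 1) where
  bounded := ⟨1, by simp⟩
  continuousAt := Eventually.of_forall fun _ => continuousAt_const
  ca_eq := by simp
  shift_eq z := by simp [spacePow_one]
  ne_zero h0 := by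
    have := hne.to_subtype
    have := residual_neBot (X := 𝔄)
    obtain ⟨a, ha⟩ := h0.exists
    exact one_ne_zero ha

/-- The a.e. spectrum as a subgroup of the torus. -/
def aeSpecSubgroup [BaireSpace 𝔄] (h𝔄 : IsSubshift 𝔄)
    (h : ProjectivelyTransitive 𝔄) (hne : 𝔄.Nonempty) (Φ : Config A D → Config A D) :
    Subgroup (Torus D) where
  carrier := aeSpec 𝔄 Φ
  one_mem' := ⟨_, isAEEigenfunction_one hne⟩
  mul_mem' := fun ⟨_, hf⟩ ⟨_, hg⟩ => ⟨_, hf.mul h𝔄 h hne hg⟩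
  inv_mem' := fun ⟨_, hf⟩ => ⟨_, hf.conj⟩

/-- A.e. eigenfunctions with the same eigenvalue are a.e. proportional. -/
lemma IsAEEigenfunction.eventually_eq_const_mul [BaireSpace 𝔄] (h𝔄 : IsSubshift 𝔄)
    (h : ProjectivelyTransitive 𝔄) (hne : 𝔄.Nonempty) (hf : IsAEEigenfunction 𝔄 Φ l f)
    (hg : IsAEEigenfunction 𝔄 Φ l g) :
    ∃ c ≠ 0, ∀ᶠ a : 𝔄 in residual 𝔄, f a = c * g a := by
  -- The product of `f` with the conjugate of `g` has eigenvalue 1, hence is a.e. a constant `k`;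
  -- dividing by the squared modulus of `g` recovers `f`.
  have hm := hf.mul h𝔄 h hne hg.conj
  rw [mul_inv_cancel] at hm
  obtain ⟨k, hk⟩ := h.eventually_const h𝔄 hne (f := fun a => f a * star (g a)) hm.continuousAt
    (fun z => (hm.shift_eq z).mono fun a ha => by simpa [spacePow_one] using ha)
  obtain ⟨r, hr, hgr⟩ := hg.eventually_norm_eq h𝔄 h hne
  have hk0 : k ≠ 0 := by
    rintro rfl
    exact hm.ne_zero hk
  have hr0 : (r : ℂ) ≠ 0 := by exact_mod_cast hr.ne'
  refine ⟨k / r ^ 2, div_ne_zero hk0 (pow_ne_zero 2 hr0), (hk.and hgr).mono fun a ha => ?_⟩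
  have h2 : star (g a) * g a = (r : ℂ) ^ 2 := by
    have := Complex.conj_mul' (g a)
    rw [ha.2] at this
    exact this
  rw [← ha.1, div_mul_eq_mul_div, mul_assoc, h2, mul_div_assoc, div_self (pow_ne_zero 2 hr0),
    mul_one]

/-! ### Values on fragments -/

lemma isOpen_setOf_eqOn_box [DiscreteTopology A] (d : Config A D) (y : Fin D → ℤ) (r : ℕ) :
    IsOpen {b : Config A D | EqOn b d (box y r)} := by
  have : {b : Config A D | EqOn b d (box y r)} = (box y r).pi fun z => {d z} := by
    ext b; simp [EqOn, Set.mem_pi]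
  rw [this]
  exact isOpen_set_pi (finite_box y r) fun _ _ => isOpen_discrete _

variable {F : Torus D → Config A D → ℂ} {Y : Set (Fin D → ℤ)}

lemma regularSet_map_shift {b : Config A D} (hb : b ∈ regularSet 𝔄 Φ F) (hl : l ∈ aeSpec 𝔄 Φ)
    (z : Fin D → ℤ) : F l (shift z b) = spacePow l z * F l b := by
  simpa using hb.2 l hl 0 z

/-- This is goodness of `d` itself (`n = 0`, `z = 0`), with `F l (shift y d)` evaluated by
regularity. -/
lemma exists_box_of_mem_goodSet (h𝔄 : IsSubshift 𝔄) {d : Config A D} (hd : d ∈ goodSet 𝔄 Φ F Y) (hl : l ∈ aeSpec 𝔄 Φ)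
    (k : ℕ) {ε : ℝ} (hε : 0 < ε) :
    ∃ r y, box y r ⊆ core Y k ∧ ∀ b ∈ 𝔄, EqOn b d (box y r) →
      ‖F l (shift y b) - spacePow l y * F l d‖ < ε := by
  obtain ⟨-, r, y, hy, -, hdet⟩ := hd.2 l hl k ε hε 0 0
  simp only [Function.iterate_zero, id, shift_zero] at hdet
  refine ⟨r, y, hy.2, fun b hb hbd => ?_⟩
  rw [← regularSet_map_shift hd.1 hl]
  exact hdet _ (h𝔄.shift_mem y hb) (eqOn_shift_box_zero.2 hbd)

/-- A regular point that agrees with a good point on an interior of `Y` has the same values. -/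
lemma eq_of_mem_goodSet_of_eqOn_core (h𝔄 : IsSubshift 𝔄) {b d : Config A D} (hd : d ∈ goodSet 𝔄 Φ F Y)
    (hb : b ∈ regularSet 𝔄 Φ F) (hl : l ∈ aeSpec 𝔄 Φ) {k : ℕ} (hbd : EqOn b d (core Y k)) :
    F l b = F l d := by
  refine eq_of_norm_sub_le_zero (le_of_forall_gt_imp_ge_of_dense fun ε hε => ?_)
  obtain ⟨r, y, hy, h⟩ := exists_box_of_mem_goodSet h𝔄 hd hl k hε
  have := h b hb.1 (hbd.mono hy)
  -- Both points are regular, so the two values carry the same unimodular phase, which drops out.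
  rw [regularSet_map_shift hb hl, ← mul_sub, norm_mul, Circle.norm_coe, one_mul] at this
  exact this.le

/-- The value of an eigenfunction on a fragment of a good point is its limit along comeager sets
at every point of the subshift that extends the fragment. -/
lemma tendsto_of_mem_goodSet [DiscreteTopology A] (h𝔄 : IsSubshift 𝔄)
    {d : Config A D} (hd : d ∈ goodSet 𝔄 Φ F Y)
    (hf : IsAEEigenfunction 𝔄 Φ l (F l)) (b : 𝔄) (hbd : EqOn (b : Config A D) d Y) :
    Tendsto (fun x : 𝔄 => F l x) (𝓝 b ⊓ residual 𝔄) (𝓝 (F l d)) := by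
  refine Metric.tendsto_nhds.2 fun ε hε => ?_
  obtain ⟨r, y, hy, h⟩ := exists_box_of_mem_goodSet h𝔄 hd ⟨_, hf⟩ 0 hε
  have hyY := hy.trans (core_subset Y 0)
  have hnear : ∀ᶠ x : 𝔄 in 𝓝 b, EqOn (x : Config A D) d (box y r) :=
    ((isOpen_setOf_eqOn_box d y r).preimage continuous_subtype_val).mem_nhds (hbd.mono hyY)
  -- The shift equation is needed only at generic points near `b`, not at `b`.
  filter_upwards [hnear.filter_mono inf_le_left, (hf.shift_eq y).filter_mono inf_le_right]
    with x hx hs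
  have := h x x.2 hx
  rwa [hs, ← mul_sub, norm_mul, Circle.norm_coe, one_mul, ← dist_eq_norm] at this

end Spectrum

section Values

variable [TopologicalSpace A] {𝔄 : Set (Config A D)}
  {Φ : Config A D → Config A D} {l : Torus D} {F : Torus D → Config A D → ℂ}
  {Y : Set (Fin D → ℤ)}

lemma fragmentValue_eq (h𝔄 : IsSubshift 𝔄) {a d : Config A D} (hd : d ∈ goodSet 𝔄 Φ F Y)
    (hda : EqOn d a Y) (hl : l ∈ aeSpec 𝔄 Φ) : fragmentValue 𝔄 Φ F l Y a = F l d := by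
  have h : ∃ b ∈ regularSet 𝔄 Φ F, EqOn b a Y := ⟨d, hd.1, hda⟩
  rw [fragmentValue, dif_pos h]
  exact eq_of_mem_goodSet_of_eqOn_core h𝔄 hd h.choose_spec.1 hl (k := 0)
    ((h.choose_spec.2.trans hda.symm).mono (core_subset Y 0))

lemma norm_eq_of_mem_goodSet [DiscreteTopology A] [BaireSpace 𝔄] (h𝔄 : IsSubshift 𝔄)
    {d : Config A D} (hd : d ∈ goodSet 𝔄 Φ F Y) (hf : IsAEEigenfunction 𝔄 Φ l (F l)) {c : ℝ}
    (hc : ∀ᶠ a : 𝔄 in residual 𝔄, ‖F l a‖ = c) : ‖F l d‖ = c := by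
  have := nhds_inf_residual_neBot (⟨d, hd.1.1⟩ : 𝔄)
  refine tendsto_nhds_unique
    (tendsto_of_mem_goodSet h𝔄 hd hf ⟨d, hd.1.1⟩ (eqOn_refl _ _)).norm ?_
  exact tendsto_const_nhds.congr' ((hc.filter_mono inf_le_right).mono fun _ hx => hx.symm)

end Values

/-! ### Continuous eigenfunctions -/

/-- The gap is a quotient of the local phases `λ^{-z} g_z(a)` at the two sites, so each site can be
treated separately. -/
lemma phaseGap_eq_div (𝔄 : Set (Config A D)) (g : Config A D → ℂ) (r : ℕ) (l : Torus D) (a : Config A D)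
    (y z : Fin D → ℤ) :
    phaseGap 𝔄 g r l a y z = ((spacePow l z : ℂ)⁻¹ * localValue 𝔄 g r z a) /
      ((spacePow l y : ℂ)⁻¹ * localValue 𝔄 g r y a) := by
  rw [phaseGap, sub_eq_add_neg, spacePow_add, spacePow_neg, Circle.coe_mul, Circle.coe_inv,
    mul_div_mul_comm, inv_div_inv]
  ring

section Rational

variable [TopologicalSpace A] {𝔄 : Set (Config A D)} {Φ : Config A D → Config A D}
  {l : Torus D} {g : Config A D → ℂ}

lemma IsEigenfunction.isAEEigenfunction [Finite A] [BaireSpace 𝔄] (h𝔄 : IsSubshift 𝔄)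
    (hg : IsEigenfunction 𝔄 Φ l g) : IsAEEigenfunction 𝔄 Φ l g where
  bounded := h𝔄.1.isCompact.exists_bound_of_continuousOn hg.continuousOn
  continuousAt := Eventually.of_forall fun _ =>
    (continuousOn_iff_continuous_domRestrict.1 hg.continuousOn).continuousAt
  ca_eq := Eventually.of_forall fun a => hg.ca_eq a a.2
  shift_eq z := Eventually.of_forall fun a => hg.shift_eq z a a.2
  ne_zero h0 := by
    obtain ⟨a, ha, hga⟩ := hg.ne_zero
    have hc := (continuousOn_iff_continuous_domRestrict.1 hg.continuousOn).continuousAt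
      (x := (⟨a, ha⟩ : 𝔄))
    have := nhds_inf_residual_neBot (⟨a, ha⟩ : 𝔄)
    obtain ⟨x, hx, hx'⟩ := (((hc.eventually_ne hga).filter_mono inf_le_left).and
      (h0.filter_mono inf_le_right)).exists
    exact hx hx'

/-- A function that is locally constant on a subshift has finite radius. -/
lemma exists_hasRadius_of_eventually_eq [Finite A] [DiscreteTopology A] (h𝔄 : IsSubshift 𝔄)
    (h : ∀ a ∈ 𝔄, ∀ᶠ b in 𝓝[𝔄] a, g b = g a) : ∃ r, HasRadius 𝔄 g r := by
  have hr : ∀ a ∈ 𝔄, ∃ r : ℕ, ∀ b ∈ 𝔄, EqOn b a (box 0 r) → g b = g a := by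
    intro a ha
    obtain ⟨U, hU, haU, hUg⟩ := mem_nhdsWithin.1 (h a ha)
    obtain ⟨I, u, hIu, hsub⟩ := isOpen_pi_iff.1 hU a haU
    -- A crude radius whose box about the origin contains the finite set `I`.
    refine ⟨∑ z ∈ I, ∑ i, (z i).natAbs, fun b hb hba => hUg ⟨hsub ?_, hb⟩⟩
    intro z hz
    rw [hba]
    · exact (hIu z hz).2
    · intro i
      have h1 : (z i).natAbs ≤ ∑ i, (z i).natAbs :=
        Finset.single_le_sum (f := fun i => (z i).natAbs) (fun _ _ => Nat.zero_le _)
          (Finset.mem_univ i)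
      have h2 : ∑ i, (z i).natAbs ≤ ∑ z ∈ I, ∑ i, (z i).natAbs :=
        Finset.single_le_sum (f := fun z : Fin D → ℤ => ∑ i, (z i).natAbs)
          (fun _ _ => Nat.zero_le _) hz
      rw [Pi.zero_apply, sub_zero, Int.abs_eq_natAbs]
      exact_mod_cast h1.trans h2
  choose! r hr using hr
  obtain ⟨t, ht𝔄, hcov⟩ := h𝔄.1.isCompact.elim_nhds_subcover
    (fun a => {b | EqOn b a (box 0 (r a))})
    fun a _ => (isOpen_setOf_eqOn_box a 0 (r a)).mem_nhds (eqOn_refl _ _)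
  refine ⟨t.sup r, fun b hb c hc hbc => ?_⟩
  have hb' := hcov hb
  simp only [mem_iUnion] at hb'
  obtain ⟨a, hat, hba⟩ := hb'
  have hbc' : EqOn c b (box 0 (r a)) :=
    (hbc.mono (box_mono 0 (Finset.le_sup (f := r) hat))).symm
  rw [hr a (ht𝔄 a hat) b hb hba, hr a (ht𝔄 a hat) c hc (hbc'.trans hba)]

/-- If `l ^ q = 1`, then `g ^ q` is invariant, hence constant. So `g` takes values among finitely
many roots, and continuity makes it locally constant. -/
lemma IsEigenfunction.exists_hasRadius [Finite A] [DiscreteTopology A] [BaireSpace 𝔄]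
    (h𝔄 : IsSubshift 𝔄) (h : ProjectivelyTransitive 𝔄) (hne : 𝔄.Nonempty)
    (hg : IsEigenfunction 𝔄 Φ l g) (hl : IsOfFinOrder l) : ∃ r, HasRadius 𝔄 g r := by
  obtain ⟨q, hq, hlq⟩ := isOfFinOrder_iff_pow_eq_one.1 hl
  have hcont : Continuous fun x : 𝔄 => g x :=
    continuousOn_iff_continuous_domRestrict.1 hg.continuousOn
  obtain ⟨c, hc⟩ := h.eventually_const h𝔄 hne (f := fun a => g a ^ q)
    (Eventually.of_forall fun _ => (hcont.pow q).continuousAt)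
    (fun z => Eventually.of_forall fun a => by
      rw [hg.shift_eq z a a.2, mul_pow, ← Circle.coe_pow, ← spacePow_pow, hlq, spacePow_one]
      simp)
  have hconst : ∀ a ∈ 𝔄, g a ^ q = c := fun a ha => by
    have := Continuous.ext_on (dense_of_mem_residual hc) (hcont.pow q) continuous_const
      fun x hx => hx
    exact congrFun this (⟨a, ha⟩ : 𝔄)
  have hfin : {w : ℂ | w ^ q = c}.Finite := by
    refine (Polynomial.nthRoots q c).toFinset.finite_toSet.subset fun w hw => ?_
    simpa [Polynomial.mem_nthRoots hq] using hw
  refine exists_hasRadius_of_eventually_eq h𝔄 fun a ha => ?_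
  have hopen : ({w : ℂ | w ^ q = c} \ {g a})ᶜ ∈ 𝓝 (g a) :=
    (hfin.subset sdiff_subset).isClosed.isOpen_compl.mem_nhds (by simp)
  filter_upwards [hg.continuousOn a ha hopen, self_mem_nhdsWithin] with b hb hb𝔄
  by_contra hne'
  exact hb ⟨hconst b hb𝔄, hne'⟩

lemma IsEigenfunction.localValue_eq (h𝔄 : IsSubshift 𝔄) (hg : IsEigenfunction 𝔄 Φ l g) {r : ℕ}
    (hr : HasRadius 𝔄 g r) {a b : Config A D} {z : Fin D → ℤ} (hb : b ∈ 𝔄)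
    (hba : EqOn b a (box z r)) : localValue 𝔄 g r z a = spacePow l z * g b := by
  have hba' := eqOn_shift_box_zero.2 hba
  have h : ∃ c ∈ 𝔄, EqOn c (shift z a) (box 0 r) := ⟨_, h𝔄.shift_mem z hb, hba'⟩
  rw [localValue, dif_pos h, ← hg.shift_eq z b hb]
  exact hr _ h.choose_spec.1 _ (h𝔄.shift_mem z hb) (h.choose_spec.2.trans hba'.symm)

/-- Along a trail of unflawed points, the phase of a continuous eigenfunction does not change. -/
lemma IsEigenfunction.phase_eq_of_trailIn (h𝔄 : IsSubshift 𝔄) (hg : IsEigenfunction 𝔄 Φ l g)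
    {r r' : ℕ} (hr' : HasRadius 𝔄 g r') (hr : r' + 1 ≤ r) {a : Config A D} {y z : Fin D → ℤ}
    (h : TrailIn (unflawed 𝔄 a r) y z) :
    (spacePow l y : ℂ)⁻¹ * localValue 𝔄 g r' y a =
      (spacePow l z : ℂ)⁻¹ * localValue 𝔄 g r' z a := by
  obtain ⟨hy, h⟩ := h
  induction h with
  | refl => rfl
  | @tail u v hu huv ih =>
    -- Since `r ≥ r' + 1`, the admissible block at `u` contains the `r'`-blocks at `u` and at its
    -- neighbour `v`; one `b ∈ 𝔄` computes both local values.
    obtain ⟨b, hb, hba⟩ := admissible_of_mem_unflawed (by omega)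
      (TrailIn.mem_right (U := unflawed 𝔄 a r) ⟨hy, hu⟩)
    rw [ih, hg.localValue_eq h𝔄 hr' hb (hba.mono (box_mono u (by omega))),
      hg.localValue_eq h𝔄 hr' hb (hba.mono (box_subset_box huv.1.2 hr)),
      inv_mul_cancel_left₀ (Circle.coe_ne_zero _), inv_mul_cancel_left₀ (Circle.coe_ne_zero _)]

end Rational

variable [TopologicalSpace A] [DiscreteTopology A] {𝔄 : Set (Config A D)}
  {Φ : Config A D → Config A D} {F : Torus D → Config A D → ℂ} {l : Torus D}
  {Y : Set (Fin D → ℤ)} {d : Config A D}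

/-! ### Displacements -/

/-- If `g = k * F l` a.e., then the limits of `g` and `k` along comeager sets, at a point that extends
a good fragment, are related through the value of `F l` on that fragment. -/
lemma eq_of_tendsto_of_eventually_eq [BaireSpace 𝔄] (h𝔄 : IsSubshift 𝔄)
    (hd : d ∈ goodSet 𝔄 Φ F Y) (hf : IsAEEigenfunction 𝔄 Φ l (F l)) {x : 𝔄}
    (hxd : EqOn (x : Config A D) d Y) {g k : 𝔄 → ℂ} {v w : ℂ}
    (hg : Tendsto g (𝓝 x ⊓ residual 𝔄) (𝓝 v)) (hk : Tendsto k (𝓝 x ⊓ residual 𝔄) (𝓝 w))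
    (h : ∀ᶠ b : 𝔄 in residual 𝔄, g b = k b * F l b) : v = w * F l d := by
  have := nhds_inf_residual_neBot x
  exact tendsto_nhds_unique hg ((hk.mul (tendsto_of_mem_goodSet h𝔄 hd hf x hxd)).congr'
    ((h.filter_mono inf_le_right).mono fun _ hb => hb.symm))

end CADefect

theorem mainTheorem3 {A : Type*} [Finite A] [TopologicalSpace A] [DiscreteTopology A]
    {D : ℕ} (hD : 1 ≤ D)
    (Φ : Config A D → Config A D) (hΦ : IsCA Φ)
    (𝔄 : Set (Config A D)) (h𝔄 : IsSubshift 𝔄) (htrans : ProjectivelyTransitive 𝔄)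
    (hinv : Φ '' 𝔄 = 𝔄)
    (F : Torus D → Config A D → ℂ) (hF : IsEigenset 𝔄 Φ F)
    {N : ℕ} (Y : Fin N → Set (Fin D → ℤ)) (hY : ∀ n, Spacious (Y n))
    (hdisj : Pairwise fun n m => Disjoint (Y n) (Y m))
    (a : Config A D) (ha : a ∈ hatSet 𝔄 Φ F Y) :
    -- `f_λ(a_{Y_n})` is well defined (every regular extension gives the same value) and nonzero
    (∀ n, ∀ l ∈ aeSpec 𝔄 Φ, fragmentValue 𝔄 Φ F l (Y n) a ≠ 0 ∧
      ∀ b ∈ regularSet 𝔄 Φ F, EqOn b a (Y n) → F l b = fragmentValue 𝔄 Φ F l (Y n) a) ∧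
    -- (a) `δ_{nm}` does not depend on the choice of the eigenfunctions
    (∀ F' : Torus D → Config A D → ℂ, IsEigenset 𝔄 Φ F' → a ∈ hatSet 𝔄 Φ F' Y →
      ∀ n m, ∀ l ∈ aeSpec 𝔄 Φ, displacement 𝔄 Φ F' Y a n m l = displacement 𝔄 Φ F Y a n m l) ∧
    -- (b) the a.e. spectrum is a group and `δ_{nm}` is a character of it
    (∃ S : Subgroup (Torus D), (S : Set (Torus D)) = aeSpec 𝔄 Φ ∧
      ∀ n m, ∃ χ : S →* Circle, ∀ l : S, (χ l : ℂ) = displacement 𝔄 Φ F Y a n m l) ∧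
    -- (c) cocycle identity
    (∀ n m k, ∀ l ∈ aeSpec 𝔄 Φ, displacement 𝔄 Φ F Y a n k l =
      displacement 𝔄 Φ F Y a n m l * displacement 𝔄 Φ F Y a m k l) ∧
    -- (d) a nontrivial `δ_{nm}` forces a projective domain boundary between `Y_n` and `Y_m`
    (∀ n m, (∃ l ∈ aeSpec 𝔄 Φ, displacement 𝔄 Φ F Y a n m l ≠ 1) →
      a ∉ 𝔄 ∧
      (∀ r : ℕ, 0 < r → ∀ (R : ℕ) (C : Set (Fin D → ℤ)), IsProjectiveComponent 𝔄 a r C →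
        ¬ (core (Y n) R ⊆ C ∧ core (Y m) R ⊆ C)) ∧
      (LiesInProjectiveComponent 𝔄 a (Y n) → LiesInProjectiveComponent 𝔄 a (Y m) →
        HasProjectiveDomainBoundary 𝔄 a ∧
          ProjectiveDomainBoundaryBetween 𝔄 a (Y n) (Y m))) ∧
    (∀ n, (∃ R : ℕ, 0 < R ∧ TrailConnected (core (Y n) R)) →
      LiesInProjectiveComponent 𝔄 a (Y n)) ∧
    -- (e) at a rational eigenvalue, `δ_{nm}` is the phase gap of the continuous eigenfunctions
    (∀ l ∈ ratSpec 𝔄 Φ, l ∈ aeSpec 𝔄 Φ ∧ ∀ g, IsEigenfunction 𝔄 Φ l g →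
      (∃ r' : ℕ, HasRadius 𝔄 g r') ∧
      ∀ r' : ℕ, HasRadius 𝔄 g r' → ∀ n m,
        (∀ y ∈ core (Y n) r', ∀ z ∈ core (Y m) r',
          phaseGap 𝔄 g r' l a z y = displacement 𝔄 Φ F Y a n m l) ∧
        (∀ r : ℕ, r' + 1 ≤ r → ∀ C C' : Set (Fin D → ℤ),
          IsTrailComponent (unflawed 𝔄 a r) C → IsTrailComponent (unflawed 𝔄 a r) C' →
          (C ∩ core (Y n) r').Nonempty → (C' ∩ core (Y m) r').Nonempty →
          ∀ y ∈ C, ∀ z ∈ C',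
            phaseGap 𝔄 g r' l a z y = displacement 𝔄 Φ F Y a n m l)) := by
  have := h𝔄.baireSpace
  have hne := nonempty_of_mem_slightlyDefective ha.1
  choose d hd hda using ha.2.2
  have hd𝔄 : ∀ n, d n ∈ 𝔄 := fun n => (hd n).1.1
  have hval : ∀ n, ∀ l ∈ aeSpec 𝔄 Φ, fragmentValue 𝔄 Φ F l (Y n) a = F l (d n) :=
    fun n l hl => fragmentValue_eq h𝔄 (hd n) (hda n) hl
  have hdisp : ∀ n m, ∀ l ∈ aeSpec 𝔄 Φ,
      displacement 𝔄 Φ F Y a n m l = F l (d n) / F l (d m) := fun n m l hl => by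
    rw [displacement, hval n l hl, hval m l hl]
  have hnorm : ∀ l ∈ aeSpec 𝔄 Φ, ∃ c : ℝ, 0 < c ∧ ∀ n, ‖F l (d n)‖ = c := fun l hl => by
    obtain ⟨c, hc, hfc⟩ := (hF l hl).eventually_norm_eq h𝔄 htrans hne
    exact ⟨c, hc, fun n => norm_eq_of_mem_goodSet h𝔄 (hd n) (hF l hl) hfc⟩
  have hne0 : ∀ n, ∀ l ∈ aeSpec 𝔄 Φ, F l (d n) ≠ 0 := fun n l hl => by
    obtain ⟨c, hc, hcn⟩ := hnorm l hl
    exact norm_pos_iff.1 (hcn n ▸ hc)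
  have hdisp_norm : ∀ n m, ∀ l ∈ aeSpec 𝔄 Φ, ‖displacement 𝔄 Φ F Y a n m l‖ = 1 :=
    fun n m l hl => by
      obtain ⟨c, hc, hcn⟩ := hnorm l hl
      rw [hdisp n m l hl, norm_div, hcn, hcn, div_self hc.ne']
  have hlim : ∀ n, ∀ l ∈ aeSpec 𝔄 Φ, Tendsto (fun x : 𝔄 => F l x)
      (𝓝 (⟨d n, hd𝔄 n⟩ : 𝔄) ⊓ residual 𝔄) (𝓝 (F l (d n))) := fun n l hl =>
    tendsto_of_mem_goodSet h𝔄 (hd n) (hF l hl) ⟨d n, hd𝔄 n⟩ (eqOn_refl _ _)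
  have hsep : ∀ n m, (∃ l ∈ aeSpec 𝔄 Φ, displacement 𝔄 Φ F Y a n m l ≠ 1) →
      ∀ r : ℕ, 0 < r → ∀ (R : ℕ) (C : Set (Fin D → ℤ)), IsProjectiveComponent 𝔄 a r C →
        ¬ (core (Y n) R ⊆ C ∧ core (Y m) R ⊆ C) := by
    rintro n m ⟨l, hl, hδ⟩ r hr R C hC ⟨hnC, hmC⟩
    obtain ⟨b, hb, hba⟩ := ha.2.1 r hr C hC
    have key : ∀ k, core (Y k) R ⊆ C → F l b = F l (d k) := fun k hk =>
      eq_of_mem_goodSet_of_eqOn_core h𝔄 (hd k) hb hl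
        ((hba.mono hk).trans ((hda k).mono (core_subset _ R)).symm)
    refine hδ ?_
    rw [hdisp n m l hl, ← key n hnC, key m hmC, div_self (hne0 m l hl)]
  refine ⟨fun n l hl => ?_, fun F' hF' ha' n m l hl => ?_, ?_, fun n m k l hl => ?_,
    fun n m hδ => ⟨?_, hsep n m hδ, ?_⟩, ?_, ?_⟩
  · rw [hval n l hl]
    refine ⟨hne0 n l hl, fun b hb hba => ?_⟩
    exact eq_of_mem_goodSet_of_eqOn_core h𝔄 (hd n) hb hl (k := 0)
      ((hba.trans (hda n).symm).mono (core_subset _ 0))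
  · choose d' hd' hda' using ha'.2.2
    obtain ⟨c, hc, hcF⟩ := (hF l hl).eventually_eq_const_mul h𝔄 htrans hne (hF' l hl)
    -- The good points for `F` and `F'` may differ off `Y k`; the limit of `F' l` at `d k` is still
    -- its value on the common fragment.
    have key : ∀ k, F l (d k) = c * F' l (d' k) := fun k =>
      eq_of_tendsto_of_eventually_eq h𝔄 (hd' k) (hF' l hl) ((hda k).trans (hda' k).symm)
        (hlim k l hl) tendsto_const_nhds hcF
    rw [hdisp n m l hl, key, key, mul_div_mul_left _ _ hc, displacement,
      fragmentValue_eq h𝔄 (hd' n) (hda' n) hl, fragmentValue_eq h𝔄 (hd' m) (hda' m) hl]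
  · refine ⟨aeSpecSubgroup h𝔄 htrans hne Φ, rfl, fun n m => ?_⟩
    have hmul : ∀ l ∈ aeSpec 𝔄 Φ, ∀ l' ∈ aeSpec 𝔄 Φ, displacement 𝔄 Φ F Y a n m (l * l') =
        displacement 𝔄 Φ F Y a n m l * displacement 𝔄 Φ F Y a n m l' := fun l hl l' hl' => by
      have hll : l * l' ∈ aeSpec 𝔄 Φ := (aeSpecSubgroup h𝔄 htrans hne Φ).mul_mem hl hl'
      obtain ⟨c, hc, hcF⟩ := (hF _ hll).eventually_eq_const_mul h𝔄 htrans hne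
        ((hF l hl).mul h𝔄 htrans hne (hF l' hl'))
      have key : ∀ k, F (l * l') (d k) = c * F l (d k) * F l' (d k) := fun k =>
        eq_of_tendsto_of_eventually_eq h𝔄 (hd k) (hF l' hl') (x := ⟨d k, hd𝔄 k⟩) (eqOn_refl _ _)
          (hlim k _ hll) ((hlim k l hl).const_mul c) (hcF.mono fun b hb => by rw [hb, mul_assoc])
      rw [hdisp n m _ hll, hdisp n m l hl, hdisp n m l' hl', key, key, mul_div_mul_comm,
        mul_div_mul_left _ _ hc]
    refine ⟨MonoidHom.mk' (fun l => ⟨displacement 𝔄 Φ F Y a n m l,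
      mem_sphere_zero_iff_norm.2 (hdisp_norm n m l l.2)⟩) fun l l' => ?_, fun l => rfl⟩
    exact Circle.ext (hmul l l.2 l' l'.2)
  · rw [hdisp n k l hl, hdisp n m l hl, hdisp m k l hl, div_mul_div_cancel₀ (hne0 m l hl)]
  -- Here `a` need not be regular, so limits at `a` are compared instead of values.
  · intro ha𝔄
    obtain ⟨l, hl, hδ⟩ := hδ
    have := nhds_inf_residual_neBot (⟨a, ha𝔄⟩ : 𝔄)
    have key : ∀ k, Tendsto (fun x : 𝔄 => F l x) (𝓝 (⟨a, ha𝔄⟩ : 𝔄) ⊓ residual 𝔄)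
        (𝓝 (F l (d k))) := fun k =>
      tendsto_of_mem_goodSet h𝔄 (hd k) (hF l hl) ⟨a, ha𝔄⟩ (hda k).symm
    rw [hdisp n m l hl, tendsto_nhds_unique (key n) (key m), div_self (hne0 m l hl)] at hδ
    exact hδ rfl
  · rintro ⟨r₁, hr₁, R₁, C₁, hC₁, hR₁⟩ ⟨r₂, hr₂, R₂, C₂, hC₂, hR₂⟩
    obtain ⟨C, hC, hCC⟩ := hC₁.exists_superset (min_le_left r₁ r₂)
    obtain ⟨C', hC', hCC'⟩ := hC₂.exists_superset (min_le_right r₁ r₂)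
    have hn : core (Y n) (max R₁ R₂) ⊆ C :=
      ((core_antitone _ (le_max_left _ _)).trans hR₁).trans hCC
    have hm : core (Y m) (max R₁ R₂) ⊆ C' :=
      ((core_antitone _ (le_max_right _ _)).trans hR₂).trans hCC'
    have hr : 0 < min r₁ r₂ := lt_min hr₁ hr₂
    have hCne : C ≠ C' := by
      rintro rfl
      exact hsep n m hδ _ hr _ C hC ⟨hn, hm⟩
    exact ⟨⟨_, C, C', hC, hC', hCne⟩, _, hr, _, C, C', hC, hC', hCne, hn, hm⟩
  · rintro n ⟨R, hR, hc⟩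
    exact liesInProjectiveComponent_of_trailConnected_core (hY n) (hd𝔄 n) (hda n) hR hc
  · rintro l ⟨⟨f, hf⟩, hfin⟩
    have hl : l ∈ aeSpec 𝔄 Φ := ⟨f, hf.isAEEigenfunction h𝔄⟩
    refine ⟨hl, fun g hg => ⟨hg.exists_hasRadius h𝔄 htrans hne hfin, fun r' hr' n m => ?_⟩⟩
    obtain ⟨c, hc, hcF⟩ :=
      (hg.isAEEigenfunction h𝔄).eventually_eq_const_mul h𝔄 htrans hne (hF l hl)
    have key : ∀ k, g (d k) = c * F l (d k) := fun k =>
      eq_of_tendsto_of_eventually_eq h𝔄 (hd k) (hF l hl) (x := ⟨d k, hd𝔄 k⟩) (eqOn_refl _ _)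
        (((continuousOn_iff_continuous_domRestrict.1 hg.continuousOn).tendsto _).mono_left
          inf_le_left) tendsto_const_nhds hcF
    have hphase : ∀ k, ∀ y ∈ core (Y k) r',
        (spacePow l y : ℂ)⁻¹ * localValue 𝔄 g r' y a = c * F l (d k) := fun k y hy => by
      rw [hg.localValue_eq h𝔄 hr' (hd𝔄 k) ((hda k).mono hy.2),
        inv_mul_cancel_left₀ (Circle.coe_ne_zero _), key]
    have hcomp : ∀ k, ∀ r, r' + 1 ≤ r → ∀ C, IsTrailComponent (unflawed 𝔄 a r) C →
        (C ∩ core (Y k) r').Nonempty → ∀ y ∈ C,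
          (spacePow l y : ℂ)⁻¹ * localValue 𝔄 g r' y a = c * F l (d k) := by
      -- Transport the phase along a trail in the component from `y` to a point `y₀` of the interior
      -- of `Y k`, where it is known.
      rintro k r hr C ⟨x, -, rfl⟩ ⟨y₀, hxy₀, hy₀⟩ y hxy
      rw [← hphase k y₀ hy₀]
      exact hg.phase_eq_of_trailIn h𝔄 hr' hr (TrailIn.symm hxy |>.trans hxy₀)
    refine ⟨fun y hy z hz => ?_, fun r hr C C' hC hC' hn hm y hy z hz => ?_⟩
    · rw [phaseGap_eq_div, hphase n y hy, hphase m z hz, mul_div_mul_left _ _ hc, hdisp n m l hl]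
    · rw [phaseGap_eq_div, hcomp n r hr C hC hn y hy, hcomp m r hr C' hC' hm z hz,
        mul_div_mul_left _ _ hc, hdisp n m l hl]
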